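/- Let $k$ be an algebraically closed field and let $\mathcal{C}$ be a finite tensor category over $k$: that is, $\mathcal{C}$ is a $k$-linear abelian rigid monoidal category whose unit object $\mathbf{1}$ is simple, whose tensor product $\otimes$ is $k$-linear in both variables, in which every object has finite length and every hom-space is finite-dimensional over $k$, and which is $k$-linearly equivalent to the category of finitely generated modules over a finite-dimensional $k$-algebra. Let $G(\mathcal{C}) = \mathrm{Aut}_\otimes(\mathrm{id}_{\mathcal{C}})$ be the group of monoidal natural automorphisms of the identity functor. Let $I$ be the set of isomorphism classes of simple objects of $\mathcal{C}$, and for each $i \in I$ fix a representative $S_i \in i$. By Schur's lemma $\mathrm{End}_{\mathcal{C}}(S_i) = k \cdot \mathrm{id}_{S_i}$, and there is a group homomorphism $$\varphi : G(\mathcal{C}) \to \mathrm{Map}(I, k^\times), \qquad \varphi(g)(i) = \text{the scalar by which } g|_{S_i} \text{ acts on } S_i .$$ A block of $\mathcal{C}$ is an equivalence class of indecomposable objects under the smallest equivalence relation for which $X$ and $Y$ are equivalent whenever $\mathrm{Hom}_{\mathcal{C}}(X, Y) \neq 0$. Then the image of $\varphi$ is exactly the set of all functions $\lambda : I \to k^\times$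 that satisfy the following two conditions: 1. for all $i, j, m \in I$, $\lambda(i)\lambda(j) = \lambda(m)$ whenever $S_m$ is a composition factor of $S_i \otimes S_j$; 2. for all $i, j \in I$, $\lambda(i) = \lambda(j)$ whenever $S_i$ and $S_j$ belong to the same block. -/

import Mathlib

open CategoryTheory MonoidalCategory Limits

universe w v u

namespace FinTens

/-- An object of an abelian category is of finite length if its poset of subobjects satisfies both
chain conditions (equivalently, if it has a composition series). -/
def HasFiniteLength {C : Type u} [Category.{v} C] (X : C) : Prop :=
  IsNoetherianObject X ∧ IsArtinianObject X

/-- Tensor categories over a field `k`: a `k`-linear abelian rigid monoidal category `C` such that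
the unit object is simple, the tensor product is `k`-linear in both variables, every object is of
finite length and every hom-space is finite-dimensional. -/
class TensorCategory (k : Type w) (C : Type u) [Field k] [Category.{v} C] [Abelian C]
    [Linear k C] [MonoidalCategory C] [RigidCategory C] : Prop where
  monoidalPreadditive : MonoidalPreadditive C
  monoidalLinear : MonoidalLinear k C
  simple_unit : Simple (𝟙_ C)
  finiteLength : ∀ X : C, HasFiniteLength X
  finite_hom : ∀ X Y : C, FiniteDimensional k (X ⟶ Y)

/-- A `k`-linear category is finite if it is `k`-linearly equivalent to the category of finitely
generated modules over a finite-dimensional `k`-algebra. -/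
def IsFiniteLinearCategory (k : Type w) (C : Type u) [Field k] [Category.{v} C] [Preadditive C]
    [Linear k C] : Prop :=
  ∃ (A : Type w) (_ : Ring A) (_ : Algebra k A) (_ : FiniteDimensional k A)
    (e : C ≌ FGModuleCat.{w} A) (_ : e.functor.Additive), e.functor.Linear k

/-- Finite tensor categories over a field `k`. -/
class FiniteTensorCategory (k : Type w) (C : Type u) [Field k] [Category.{v} C] [Abelian C]
    [Linear k C] [MonoidalCategory C] [RigidCategory C] : Prop extends TensorCategory k C where
  finite : IsFiniteLinearCategory k C

/-- The group of monoidal natural automorphisms of the identity functor of `C`. -/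
def monoidalAutId (C : Type u) [Category.{v} C] [MonoidalCategory C] : Subgroup (Aut (𝟭 C)) where
  carrier := {g | NatTrans.IsMonoidal g.hom}
  mul_mem' {g h} hg hh := by
    have : NatTrans.IsMonoidal g.hom := hg
    have : NatTrans.IsMonoidal h.hom := hh
    exact NatTrans.IsMonoidal.comp h.hom g.hom
  one_mem' := NatTrans.IsMonoidal.id (F₁ := 𝟭 C)
  inv_mem' {g} hg := by
    let e : 𝟭 C ≅ 𝟭 C := g
    have : NatTrans.IsMonoidal e.hom := hg
    exact inferInstanceAs (NatTrans.IsMonoidal e.inv)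

/-- The type of simple objects of `C`. -/
abbrev SimpleObject (C : Type u) [Category.{v} C] [HasZeroMorphisms C] : Type u :=
  {X : C // Simple X}

/-- Isomorphism as an equivalence relation on simple objects. -/
def simpleIsoSetoid (C : Type u) [Category.{v} C] [HasZeroMorphisms C] :
    Setoid (SimpleObject C) :=
  (isIsomorphicSetoid C).comap Subtype.val

/-- The set of isomorphism classes of simple objects of `C`. -/
def SimpleClass (C : Type u) [Category.{v} C] [HasZeroMorphisms C] : Type u :=
  Quotient (simpleIsoSetoid C)

/-- The isomorphism class of a simple object. -/
def SimpleClass.mk {C : Type u} [Category.{v} C] [HasZeroMorphisms C] (X : SimpleObject C) :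
    SimpleClass C :=
  Quotient.mk (simpleIsoSetoid C) X

/-- `S` is a composition factor of `X`: there is a composition series
`0 = X₀ < X₁ < ⋯ < Xₙ = X` (a maximal chain of subobjects) such that `S ≅ Xᵢ₊₁ / Xᵢ` for
some `i < n`. -/
def IsCompositionFactor {C : Type u} [Category.{v} C] [Abelian C] (S X : C) : Prop :=
  ∃ s : RelSeries {(A, B) : Subobject X × Subobject X | A ⋖ B},
    s.head = ⊥ ∧ s.last = ⊤ ∧
      ∃ i : Fin s.length,
        Nonempty (S ≅ cokernel (Subobject.ofLE (s i.castSucc) (s i.succ) (s.step i).le))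

/-- Two indecomposable objects belong to the same block if they are related by the smallest
equivalence relation on indecomposable objects relating `X` and `Y` whenever
`Hom(X, Y) ≠ 0`. -/
def SameBlock {C : Type u} [Category.{v} C] [Abelian C]
    (X Y : {X : C // Indecomposable X}) : Prop :=
  Relation.EqvGen (fun X Y : {X : C // Indecomposable X} => ∃ f : X.1 ⟶ Y.1, f ≠ 0) X Y

/-- A simple object, seen as an indecomposable object. -/
def SimpleObject.toIndecomposable {C : Type u} [Category.{v} C] [Abelian C]
    (X : SimpleObject C) : {X : C // Indecomposable X} :=
  ⟨X.1, haveI := X.2; indecomposable_of_simple X.1⟩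

section Phi

variable (k : Type w) {C : Type u} [Field k] [IsAlgClosed k] [Category.{v} C] [Abelian C]
  [Linear k C] [MonoidalCategory C] [RigidCategory C] [TensorCategory k C]

/-- Schur's lemma: over an algebraically closed field, the endomorphisms of a simple object are
exactly the scalars. -/
theorem bijective_algebraMap_end (X : SimpleObject C) :
    Function.Bijective (algebraMap k (End X.1)) := by
  have := X.2
  have : FiniteDimensional k (X.1 ⟶ X.1) := TensorCategory.finite_hom X.1 X.1
  refine ⟨(algebraMap k (End X.1)).injective, fun f => ?_⟩
  obtain ⟨c, hc⟩ := endomorphism_simple_eq_smul_id k f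
  exact ⟨c, by rw [Algebra.algebraMap_eq_smul_one]; exact hc⟩

/-- The identification of `k` with the endomorphism ring of a simple object. -/
noncomputable def scalarEquivEnd (X : SimpleObject C) : k ≃+* End X.1 :=
  RingEquiv.ofBijective (algebraMap k (End X.1)) (bijective_algebraMap_end k X)

/-- The identification of the automorphism group of a simple object with `kˣ`. -/
noncomputable def autEquivUnits (X : SimpleObject C) : Aut X.1 ≃* kˣ :=
  (Aut.unitsEndEquivAut X.1).symm.trans (Units.mapEquiv (scalarEquivEnd k X).symm.toMulEquiv)

/-- The group homomorphism from the monoidal natural automorphisms of the identity functor to the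
functions `I → kˣ`, `g ↦ (i ↦ g|_{S_i})`, where `I` is the set of isomorphism classes of simple
objects and `S_i` is a fixed representative of the class `i`. -/
noncomputable def phi (S : SimpleClass C → SimpleObject C) :
    monoidalAutId C →* (SimpleClass C → kˣ) :=
  MonoidHom.pi fun i =>
    ((autEquivUnits k (S i)).toMonoidHom.comp
      (((evaluation C C).obj (S i).1).mapAut (𝟭 C))).comp (monoidalAutId C).subtype

/-- The value of `phi` at `g` and `i` is the scalar by which `g` acts on `S_i`. -/
theorem phi_spec (S : SimpleClass C → SimpleObject C) (g : monoidalAutId C) (i : SimpleClass C) :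
    g.1.hom.app (S i).1 = ((phi k S g i : kˣ) : k) • 𝟙 (S i).1 := by
  have h := (scalarEquivEnd k (S i)).apply_symm_apply (g.1.hom.app (S i).1 : End (S i).1)
  refine h.symm.trans ?_
  change algebraMap k (End (S i).1) ((phi k S g i : kˣ) : k) = _
  rw [Algebra.algebraMap_eq_smul_one]
  rfl

end Phi

end FinTens

/-!
Let `g` be a monoidal automorphism of the identity. By naturality, if `g` is a scalar on `X` then it
is the same scalar on every composition factor of `X` (`app_eq_smul_of_isCompositionFactor`); for
`X = S_i ⊗ S_j` that scalar is `λ(i) λ(j)`, since `g` is monoidal. On an indecomposable object `g`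
has a single eigenvalue by Fitting's lemma (`exists_isNilpotent_sub_algebraMap`), and a nonzero
morphism forces the eigenvalues of its source and target to agree (`eigenvalue_eq_of_ne_zero`), so
the scalar is constant on blocks.

Conversely, let `λ` satisfy both conditions. Constancy on blocks allows `λ` to be extended to a
weight function on all indecomposable objects which is constant along nonzero morphisms
(`exists_weight`). Since every object is a finite direct sum of indecomposable ones
(`prop_of_indecomposable`, `hom_ext_of_indecomposable`), each object can be acted on by multiplying
the indecomposable summands by their weights. This action is natural
(`weightNatTrans`), and no uniqueness of the decomposition is needed: the endomorphism obtained is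
characterized by its effect on morphisms from indecomposable objects. For the tensor product, the
objects to which only indecomposables of weight `c` map nontrivially (`IsHomogeneous`) are closed
under extensions. By exactness of `⊗` in a rigid category, dévissage along composition series
reduces the homogeneity of `X ⊗ Y`, for `X` and `Y` indecomposable, to the multiplicativity of `λ`
on composition factors of tensor products of simple objects (`isHomogeneous_tensor`); general `X`
and `Y` reduce to indecomposable ones because tensoring has right adjoints
(`app_tensor_of_indecomposable`).
-/

namespace FinTens

/-! ### Composition factors and dévissage -/

section Devissage

open scoped ZeroObject

variable {C : Type u} [Category.{v} C] [Abelian C]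

/-- The subquotient attached to two consecutive terms of a chain of subobjects is simple: a
subobject of the quotient pulls back to a subobject lying between the two terms. -/
theorem simple_cokernel_of_covBy {X : C} {A B : Subobject X} (h : A ⋖ B) :
    Simple (cokernel (Subobject.ofLE A B h.le)) := by
  set i := Subobject.ofLE A B h.le
  have hiA : i ≫ B.arrow = A.arrow := Subobject.ofLE_arrow h.le
  refine ⟨fun {Y} f _ => ?_⟩
  -- `P` is the preimage in `B` of the subobject `f : Y ⟶ B / A`
  let p := pullback.fst (cokernel.π i) f
  let q := pullback.snd (cokernel.π i) f
  have hpq : p ≫ cokernel.π i = q ≫ f := pullback.condition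
  have hqe : Epi q := inferInstanceAs (Epi (pullback.snd (cokernel.π i) f))
  have hpm : Mono p := inferInstanceAs (Mono (pullback.fst (cokernel.π i) f))
  let P : Subobject X := Subobject.mk (p ≫ B.arrow)
  have hAP : A ≤ P := by
    refine Subobject.le_mk_of_comm (pullback.lift i 0 (by simp)) ?_
    rw [← Category.assoc, pullback.lift_fst, hiA]
  have hPB : P ≤ B := Subobject.mk_le_of_comm p rfl
  constructor
  · rintro hf rfl
    -- if `f` were an isomorphism and zero, the quotient would vanish and `A = B`
    have hz : IsZero (cokernel i) := by
      rw [IsZero.iff_id_eq_zero, ← IsIso.inv_hom_id (0 : Y ⟶ cokernel i), comp_zero]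
    have : Epi i := Preadditive.epi_of_cokernel_zero (hz.eq_of_tgt _ _)
    have : IsIso i := isIso_of_mono_of_epi i
    exact h.lt.not_ge (Subobject.le_of_comm (inv i) (by simp [← hiA]))
  · intro hf
    rcases h.eq_or_eq hAP hPB with hP | hP
    · -- the pullback is `A`, which dies in the quotient
      exfalso
      apply hf
      have hle : P ≤ A := hP.le
      let l : pullback (cokernel.π i) f ⟶ (A : C) := Subobject.ofMkLE _ _ hle
      have hl : l ≫ A.arrow = p ≫ B.arrow := Subobject.ofMkLE_arrow hle
      have hli : l ≫ i = p := by
        rw [← cancel_mono B.arrow, Category.assoc, hiA, hl]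
      rw [← cancel_epi q, ← hpq, ← hli, Category.assoc, cokernel.condition]
      simp
    · -- the pullback is `B`, so the quotient map factors through `f`
      have hle : B ≤ P := hP.ge
      let l : (B : C) ⟶ pullback (cokernel.π i) f := Subobject.ofLEMk _ _ hle
      have hl : l ≫ p ≫ B.arrow = B.arrow := Subobject.ofLEMk_comp hle
      have hlp : l ≫ p = 𝟙 _ := by
        rw [← cancel_mono B.arrow, Category.assoc, hl, Category.id_comp]
      have hfac : (l ≫ q) ≫ f = cokernel.π i := by
        rw [Category.assoc, ← hpq, ← Category.assoc, hlp, Category.id_comp]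
      have : Epi ((l ≫ q) ≫ f) := by rw [hfac]; infer_instance
      have : Epi f := epi_of_epi (l ≫ q) f
      exact isIso_of_mono_of_epi f

theorem IsCompositionFactor.of_iso_left {S T X : C} (h : IsCompositionFactor T X) (e : S ≅ T) :
    IsCompositionFactor S X := by
  obtain ⟨s, h0, h1, i, ⟨e'⟩⟩ := h
  exact ⟨s, h0, h1, i, ⟨e ≪≫ e'⟩⟩

/-- A property of objects closed under extensions holds for an object of finite length as soon as
it holds for zero objects and for all composition factors of that object. -/
theorem prop_of_compositionFactors (P : ObjectProperty C) [P.IsClosedUnderExtensions]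
    (hP : ∀ Z : C, IsZero Z → P Z) {X : C} (hX : HasFiniteLength X)
    (h : ∀ T : C, Simple T → IsCompositionFactor T X → P T) : P X := by
  have := hX.1
  have := hX.2
  obtain ⟨f, f0, n, hn⟩ := exists_covBy_seq_of_wellFoundedLT_wellFoundedGT (Subobject X)
  let s : RelSeries {(A, B) : Subobject X × Subobject X | A ⋖ B} :=
    ⟨n, fun i => f i, fun i => hn.2 i i.2⟩
  have s_head : s.head = ⊥ := f0.eq_bot
  have s_last : s.last = ⊤ := hn.1.eq_top
  have key : ∀ i, P (s i : C) := by
    intro i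
    induction i using Fin.induction with
    | zero =>
      change P (s.head : C)
      rw [s_head]
      exact hP _ ((isZero_zero C).of_iso Subobject.botCoeIsoZero)
    | succ i ih =>
      have hcov : s i.castSucc ⋖ s i.succ := s.step i
      have hS : (ShortComplex.mk (Subobject.ofLE _ _ hcov.le) (cokernel.π _)
          (cokernel.condition _)).ShortExact :=
        { exact := ShortComplex.exact_cokernel _ }
      exact P.prop_X₂_of_shortExact hS ih
        (h _ (simple_cokernel_of_covBy hcov) ⟨s, s_head, s_last, i, ⟨Iso.refl _⟩⟩)
  have htop : P ((⊤ : Subobject X) : C) := s_last ▸ key (Fin.last _)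
  have hS : (ShortComplex.mk (⊤ : Subobject X).arrow (0 : X ⟶ 0) comp_zero).ShortExact :=
    { exact := (ShortComplex.exact_iff_epi _ rfl).2 inferInstance
      epi_g := inferInstanceAs (Epi (0 : X ⟶ 0)) }
  exact P.prop_X₂_of_shortExact hS htop (hP _ (isZero_zero C))

/-- A natural endomorphism of the identity which is a scalar on an object is the same scalar on
all its composition factors. -/
theorem app_eq_smul_of_isCompositionFactor {k : Type w} [Field k] [Linear k C]
    (g : 𝟭 C ⟶ 𝟭 C) {c : k} {T X : C} (hg : g.app X = c • 𝟙 X)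
    (h : IsCompositionFactor T X) : g.app T = c • 𝟙 T := by
  have hmono : ∀ {A B : C} (f : A ⟶ B) [Mono f], g.app B = c • 𝟙 B → g.app A = c • 𝟙 A := by
    intro A B f _ hB
    rw [← cancel_mono f]
    have := g.naturality f
    simp only [Functor.id_obj, Functor.id_map] at this
    rw [← this, hB]
    simp
  have hepi : ∀ {A B : C} (f : A ⟶ B) [Epi f], g.app A = c • 𝟙 A → g.app B = c • 𝟙 B := by
    intro A B f _ hA
    rw [← cancel_epi f]
    have := g.naturality f
    simp only [Functor.id_obj, Functor.id_map] at this
    rw [this, hA]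
    simp
  obtain ⟨s, -, -, i, ⟨e⟩⟩ := h
  exact hmono e.hom (hepi (cokernel.π _) (hmono (s i.succ).arrow hg))

end Devissage

/-! ### Indecomposable objects -/

section Indecomposables

variable {k : Type w} {C : Type u} [Field k] [Category.{v} C] [Abelian C] [Linear k C]

/-- Idempotent endomorphisms of an indecomposable object of an abelian category are trivial. -/
theorem eq_zero_or_eq_id_of_indecomposable {X : C} (hX : Indecomposable X) {p : X ⟶ X}
    (hp : p ≫ p = p) : p = 0 ∨ p = 𝟙 X := by
  -- the splitting `X ≅ ker p ⊞ im p`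
  let j := kernel.ι p
  have hj : j ≫ p = 0 := kernel.condition p
  let r : X ⟶ kernel p := kernel.lift p (𝟙 X - p) (by simp [hp])
  have hr : r ≫ j = 𝟙 X - p := kernel.lift_ι _ _ _
  let i := image.ι p
  let q := factorThruImage p
  have hqi : q ≫ i = p := image.fac p
  have hiq : i ≫ q = 𝟙 _ := by
    rw [← cancel_epi q, ← cancel_mono i]
    simp only [Category.assoc, hqi, Category.comp_id]
    rw [← Category.assoc, hqi, hp]
  have hip : i ≫ p = i := (congrArg (fun t => i ≫ t) hqi.symm).trans
    (by rw [← Category.assoc, hiq, Category.id_comp])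
  have hir : i ≫ r = 0 := by
    rw [← cancel_mono j, Category.assoc, hr]
    simp [hip]
  have hjq : j ≫ q = 0 := by
    rw [← cancel_mono i, Category.assoc, hqi, hj, zero_comp]
  have hjr : j ≫ r = 𝟙 _ := by
    rw [← cancel_mono j, Category.assoc, hr]
    simp [hj]
  let e : X ≅ kernel p ⊞ image p :=
    { hom := biprod.lift r q
      inv := biprod.desc j i
      hom_inv_id := by rw [biprod.lift_desc, hr, hqi]; simp
      inv_hom_id := by
        ext <;> simp [hjr, hjq, hir, hiq] }
  rcases hX.2 _ _ e with h | h
  · right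
    have : r = 0 := h.eq_of_tgt _ _
    rw [this, zero_comp] at hr
    exact (sub_eq_zero.1 hr.symm).symm
  · left
    have : q = 0 := h.eq_of_tgt _ _
    rw [← hqi, this, zero_comp]

/-- In a finite-dimensional algebra over an algebraically closed field without nontrivial
idempotents, every element has a single eigenvalue. This is Fitting's lemma, applied to left
multiplication by the element. -/
theorem exists_isNilpotent_sub_algebraMap [IsAlgClosed k] {R : Type*} [Ring R] [Nontrivial R]
    [Algebra k R] [FiniteDimensional k R] (hR : ∀ e : R, e * e = e → e = 0 ∨ e = 1) (x : R) :
    ∃ c : k, IsNilpotent (x - algebraMap k R c) := by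
  obtain ⟨c, hc⟩ := Module.End.exists_eigenvalue (LinearMap.mulLeft k x)
  refine ⟨c, ?_⟩
  set y := x - algebraMap k R c with hy
  let L := LinearMap.mulLeft k y
  -- `v` witnesses that left multiplication by `y = x - c` is not injective
  obtain ⟨v, hv⟩ := hc.exists_hasEigenvector
  have hyv : y * v = 0 := by
    have : x * v = c • v := hv.apply_eq_smul
    rw [hy, sub_mul, this, Algebra.smul_def, sub_self]
  obtain ⟨n, hn, hn1⟩ := (L.eventually_isCompl_ker_pow_range_pow.and
    (Filter.eventually_ge_atTop 1)).exists
  have hL : ∀ z, (L ^ n) z = y ^ n * z := fun z => by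
    rw [LinearMap.pow_mulLeft, LinearMap.mulLeft_apply]
  obtain ⟨a, ha, b, hb, hab⟩ := Submodule.mem_sup.1
    (hn.codisjoint.eq_top ▸ Submodule.mem_top : (1 : R) ∈ _)
  rw [LinearMap.mem_ker, hL] at ha
  obtain ⟨d, rfl⟩ := hb
  rw [hL] at hab
  -- the component of `1` in the kernel is idempotent
  have hidem : a * a = a := by
    have h1 : a - a * a ∈ LinearMap.ker (L ^ n) := by
      rw [LinearMap.mem_ker, hL, mul_sub, ← mul_assoc, ha]; simp
    have h2 : a - a * a ∈ LinearMap.range (L ^ n) := by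
      refine ⟨d * a, ?_⟩
      rw [hL, ← mul_assoc]
      rw [eq_sub_of_add_eq' hab]
      noncomm_ring
    exact (sub_eq_zero.1 (Submodule.disjoint_def.1 hn.disjoint _ h1 h2)).symm
  rcases hR a hidem with rfl | rfl
  · -- then `y ^ n` is right invertible, so left multiplication by `y` is injective
    exfalso
    rw [zero_add] at hab
    have hsurj : Function.Surjective (L ^ n) := fun z => ⟨d * z, by
      rw [hL, ← mul_assoc, hab, one_mul]⟩
    have hinj := LinearMap.injective_iff_surjective.2 hsurj
    refine hv.2 (hinj ?_)
    rw [hL, map_zero]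
    rw [← Nat.sub_add_cancel hn1, pow_succ, mul_assoc, hyv, mul_zero]
  · exact ⟨n, by simpa using ha⟩

variable (k) in
/-- A property of objects which is invariant under isomorphism, holds for zero objects and for
indecomposable objects and is stable under direct sums holds for all objects. -/
theorem prop_of_indecomposable (hfin : ∀ X : C, FiniteDimensional k (X ⟶ X))
    (P : ObjectProperty C) [P.IsClosedUnderIsomorphisms]
    (hzero : ∀ X : C, IsZero X → P X) (hind : ∀ X : C, Indecomposable X → P X)
    (hadd : ∀ X Y : C, P X → P Y → P (X ⊞ Y)) (X : C) : P X := by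
  -- the dimension of the endomorphism algebra drops when passing to a proper direct summand
  have hdim : ∀ Y Z : C, Module.finrank k (Y ⟶ Y) + Module.finrank k (Z ⟶ Z) ≤
      Module.finrank k (Y ⊞ Z ⟶ Y ⊞ Z) := by
    intro Y Z
    have := hfin
    rw [← Module.finrank_prod]
    let F : ((Y ⟶ Y) × (Z ⟶ Z)) →ₗ[k] (Y ⊞ Z ⟶ Y ⊞ Z) :=
      { toFun := fun p => biprod.map p.1 p.2
        map_add' := fun p q => by ext <;> simp
        map_smul' := fun c p => by ext <;> simp }
    refine LinearMap.finrank_le_finrank_of_injective (f := F) fun p q h => ?_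
    have h' : biprod.map p.1 p.2 = biprod.map q.1 q.2 := h
    have h1 := biprod.inl ≫= h' =≫ biprod.fst
    have h2 := biprod.inr ≫= h' =≫ biprod.snd
    simp at h1 h2
    exact Prod.ext h1 h2
  have hpos : ∀ Y : C, ¬ IsZero Y → 0 < Module.finrank k (Y ⟶ Y) := by
    intro Y hY
    have := hfin
    have : Nontrivial (Y ⟶ Y) := ⟨𝟙 Y, 0, fun h => hY ((IsZero.iff_id_eq_zero Y).2 h)⟩
    exact Module.finrank_pos
  induction hn : Module.finrank k (X ⟶ X) using Nat.strong_induction_on generalizing X with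
  | _ n ih =>
    by_cases hz : IsZero X
    · exact hzero X hz
    by_cases hi : Indecomposable X
    · exact hind X hi
    simp only [Indecomposable, not_and, not_forall, not_or] at hi
    obtain ⟨Y, Z, e, hY, hZ⟩ := hi hz
    have hX : Module.finrank k (X ⟶ X) = Module.finrank k (Y ⊞ Z ⟶ Y ⊞ Z) :=
      LinearEquiv.finrank_eq (Linear.homCongr k e e)
    have := hdim Y Z
    have := hpos Y hY
    have := hpos Z hZ
    exact P.prop_of_iso e.symm (hadd Y Z (ih _ (by omega) Y rfl) (ih _ (by omega) Z rfl))

variable (k) in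
/-- Morphisms out of any object are detected by composition with morphisms from indecomposable
objects. -/
theorem hom_ext_of_indecomposable (hfin : ∀ X : C, FiniteDimensional k (X ⟶ X))
    {X Y : C} {f g : X ⟶ Y}
    (h : ∀ (Z : {Z : C // Indecomposable Z}) (i : Z.1 ⟶ X), i ≫ f = i ≫ g) : f = g := by
  let P : ObjectProperty C := fun X => ∀ (f g : X ⟶ Y),
    (∀ (Z : {Z : C // Indecomposable Z}) (i : Z.1 ⟶ X), i ≫ f = i ≫ g) → f = g
  have : P.IsClosedUnderIsomorphisms := ⟨fun {A B} e hA f g h => by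
    rw [← cancel_epi e.hom]
    exact hA _ _ fun Z i => by simpa using h Z (i ≫ e.hom)⟩
  refine prop_of_indecomposable k hfin P (fun X hX f g _ => hX.eq_of_src f g)
    (fun X hX f g h => by simpa using h ⟨X, hX⟩ (𝟙 X)) (fun A B hA hB f g h => ?_) X f g h
  ext
  · exact hA _ _ fun Z i => by simpa using h Z (i ≫ biprod.inl)
  · exact hB _ _ fun Z i => by simpa using h Z (i ≫ biprod.inr)

/-- Morphisms out of a value of a left adjoint are detected on morphisms from indecomposable
objects. -/
theorem hom_ext_of_adjunction (hfin : ∀ X : C, FiniteDimensional k (X ⟶ X)) {F G : C ⥤ C}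
    (adj : F ⊣ G) {X Y : C} {f g : F.obj X ⟶ Y}
    (h : ∀ (Z : {Z : C // Indecomposable Z}) (i : Z.1 ⟶ X), F.map i ≫ f = F.map i ≫ g) :
    f = g := by
  apply (adj.homEquiv X Y).injective
  refine hom_ext_of_indecomposable k hfin fun Z i => ?_
  rw [← adj.homEquiv_naturality_left, ← adj.homEquiv_naturality_left, h]

end Indecomposables

/-! ### Weight functions on indecomposable objects -/

section Homogeneous

variable {k : Type w} {C : Type u} [Category.{v} C] [Abelian C]

/-- An object is homogeneous of weight `c` if every indecomposable object with a nonzero morphism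
to it has weight `c`. -/
def IsHomogeneous (a : {X : C // Indecomposable X} → k) (c : k) : ObjectProperty C :=
  fun X => ∀ (Z : {X : C // Indecomposable X}) (i : Z.1 ⟶ X), i ≠ 0 → a Z = c

theorem isHomogeneous_of_isZero (a : {X : C // Indecomposable X} → k) (c : k) {X : C}
    (hX : IsZero X) : IsHomogeneous a c X :=
  fun _ i hi => absurd (hX.eq_of_tgt i 0) hi

instance (a : {X : C // Indecomposable X} → k) (c : k) :
    (IsHomogeneous a c).IsClosedUnderExtensions where
  prop_X₂_of_shortExact {S} hS h₁ h₃ Z i hi := by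
    by_cases hg : i ≫ S.g = 0
    · have := hS.mono_f
      refine h₁ Z (hS.exact.lift i hg) fun h => hi ?_
      rw [← hS.exact.lift_f i hg, h, zero_comp]
    · exact h₃ Z _ hg

end Homogeneous

section Weights

variable {k : Type w} {C : Type u} [Field k] [Category.{v} C] [Abelian C] [Linear k C]

/-- Multiplication by weights. If a scalar is attached to each indecomposable object, in such a way
that objects related by a nonzero morphism have the same scalar, then every object has an
endomorphism which acts on all morphisms from an indecomposable object by the scalar of the
latter. -/
theorem exists_weightEndo (hfin : ∀ X : C, FiniteDimensional k (X ⟶ X))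
    {a : {X : C // Indecomposable X} → k}
    (ha : ∀ (X Y : {X : C // Indecomposable X}) (f : X.1 ⟶ Y.1), f ≠ 0 → a X = a Y) (X : C) :
    ∃ φ : X ⟶ X, ∀ (Z : {X : C // Indecomposable X}) (i : Z.1 ⟶ X), i ≫ φ = a Z • i := by
  let P : ObjectProperty C := fun X =>
    ∃ φ : X ⟶ X, ∀ (Z : {X : C // Indecomposable X}) (i : Z.1 ⟶ X), i ≫ φ = a Z • i
  have : P.IsClosedUnderIsomorphisms := ⟨fun {A B} e ⟨φ, hφ⟩ =>
    ⟨e.inv ≫ φ ≫ e.hom, fun Z i => by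
      have := hφ Z (i ≫ e.inv)
      rw [← Category.assoc, ← Category.assoc, this]
      simp⟩⟩
  refine prop_of_indecomposable k hfin P (fun X hX => ⟨0, fun Z i => hX.eq_of_tgt _ _⟩)
    (fun X hX => ⟨a ⟨X, hX⟩ • 𝟙 X, fun Z i => ?_⟩) (fun A B ⟨φ, hφ⟩ ⟨ψ, hψ⟩ => ?_) X
  · by_cases hi : i = 0
    · simp [hi]
    · rw [Linear.comp_smul, Category.comp_id, ha Z ⟨X, hX⟩ i hi]
  · refine ⟨biprod.map φ ψ, fun Z i => ?_⟩
    ext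
    · simpa using hφ Z (i ≫ biprod.fst)
    · simpa using hψ Z (i ≫ biprod.snd)

/-- The natural endomorphism of the identity functor which acts on each indecomposable object by
the scalar attached to it. -/
noncomputable def weightNatTrans (hfin : ∀ X : C, FiniteDimensional k (X ⟶ X))
    {a : {X : C // Indecomposable X} → k}
    (ha : ∀ (X Y : {X : C // Indecomposable X}) (f : X.1 ⟶ Y.1), f ≠ 0 → a X = a Y) :
    𝟭 C ⟶ 𝟭 C where
  app X := (exists_weightEndo hfin ha X).choose
  naturality X Y f := by
    refine hom_ext_of_indecomposable k hfin fun Z i => ?_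
    dsimp only [Functor.id_obj, Functor.id_map]
    rw [← Category.assoc, ← Category.assoc, (exists_weightEndo hfin ha Y).choose_spec,
      (exists_weightEndo hfin ha X).choose_spec, Linear.smul_comp]

section

variable (hfin : ∀ X : C, FiniteDimensional k (X ⟶ X)) {a : {X : C // Indecomposable X} → k}
  (ha : ∀ (X Y : {X : C // Indecomposable X}) (f : X.1 ⟶ Y.1), f ≠ 0 → a X = a Y)

theorem comp_weightNatTrans_app {X : C} (Z : {X : C // Indecomposable X}) (i : Z.1 ⟶ X) :
    i ≫ (weightNatTrans hfin ha).app X = a Z • i :=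
  (exists_weightEndo hfin ha X).choose_spec Z i

theorem weightNatTrans_app_of_indecomposable (X : {X : C // Indecomposable X}) :
    (weightNatTrans hfin ha).app X.1 = a X • 𝟙 X.1 := by
  simpa using comp_weightNatTrans_app hfin ha X (𝟙 X.1)

end

theorem weightNatTrans_app_of_isHomogeneous (hfin : ∀ X : C, FiniteDimensional k (X ⟶ X))
    {a : {X : C // Indecomposable X} → k}
    (ha : ∀ (X Y : {X : C // Indecomposable X}) (f : X.1 ⟶ Y.1), f ≠ 0 → a X = a Y)
    {c : k} {X : C} (hX : IsHomogeneous a c X) :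
    (weightNatTrans hfin ha).app X = c • 𝟙 X := by
  refine hom_ext_of_indecomposable k hfin fun Z i => ?_
  refine (comp_weightNatTrans_app hfin ha Z i).trans ?_
  by_cases hi : i = 0
  · simp [hi]
  · simp [hX Z i hi]

theorem weightNatTrans_comp (hfin : ∀ X : C, FiniteDimensional k (X ⟶ X))
    {a b : {X : C // Indecomposable X} → k}
    (ha : ∀ (X Y : {X : C // Indecomposable X}) (f : X.1 ⟶ Y.1), f ≠ 0 → a X = a Y)
    (hb : ∀ (X Y : {X : C // Indecomposable X}) (f : X.1 ⟶ Y.1), f ≠ 0 → b X = b Y)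
    (hab : ∀ X, a X * b X = 1) : weightNatTrans hfin ha ≫ weightNatTrans hfin hb = 𝟙 (𝟭 C) := by
  ext X
  refine hom_ext_of_indecomposable k hfin fun Z i => ?_
  have h1 : i ≫ (weightNatTrans hfin ha).app X = a Z • i := comp_weightNatTrans_app hfin ha Z i
  have h2 : i ≫ (weightNatTrans hfin hb).app X = b Z • i := comp_weightNatTrans_app hfin hb Z i
  rw [NatTrans.comp_app, ← Category.assoc, h1, Linear.smul_comp, h2, smul_smul, hab, one_smul]
  exact (Category.comp_id i).symm

/-- Multiplication by invertible weights, as an automorphism of the identity functor. -/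
noncomputable def weightAut (hfin : ∀ X : C, FiniteDimensional k (X ⟶ X))
    {b : {X : C // Indecomposable X} → kˣ}
    (hb : ∀ (X Y : {X : C // Indecomposable X}) (f : X.1 ⟶ Y.1), f ≠ 0 → b X = b Y) :
    Aut (𝟭 C) where
  hom := weightNatTrans hfin (a := fun X => (b X : k)) fun X Y f hf => by rw [hb X Y f hf]
  inv := weightNatTrans hfin (a := fun X => ((b X)⁻¹ : kˣ)) fun X Y f hf => by rw [hb X Y f hf]
  hom_inv_id := weightNatTrans_comp hfin _ _ fun X => Units.mul_inv (b X)
  inv_hom_id := weightNatTrans_comp hfin _ _ fun X => Units.inv_mul (b X)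

end Weights

/-! ### Scalars on blocks -/

section Scalars

variable {k : Type w} {C : Type u} [Field k] [Category.{v} C] [Abelian C] [Linear k C]

theorem smul_id_injective {X : C} (hX : ¬ IsZero X) :
    Function.Injective fun c : k => c • 𝟙 X := by
  intro c d h
  by_contra hcd
  refine hX ((IsZero.iff_id_eq_zero X).2 ?_)
  have : (c - d) • 𝟙 X = 0 := by rw [sub_smul]; exact sub_eq_zero.2 h
  exact (smul_eq_zero.1 this).resolve_left (sub_ne_zero.2 hcd)

/-- If a nonzero morphism intertwines two endomorphisms with a single eigenvalue each, then the two
eigenvalues agree. -/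
theorem eigenvalue_eq_of_ne_zero {X Y : C} {f : X ⟶ Y} (hf : f ≠ 0) {x : End X} {y : End Y}
    (hxy : f ≫ y = x ≫ f) {c d : k} (hc : IsNilpotent (x - algebraMap k (End X) c))
    (hd : IsNilpotent (y - algebraMap k (End Y) d)) : c = d := by
  by_contra hcd
  apply hf
  obtain ⟨n, hn⟩ := hc
  -- if `c ≠ d` then `y - c` is invertible, but its `n`-th power kills `f`
  have hunit : IsUnit (y - algebraMap k (End Y) c) := by
    have h1 : IsUnit (algebraMap k (End Y) (d - c)) :=
      (IsUnit.mk0 _ (sub_ne_zero.2 (Ne.symm hcd))).map _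
    have h2 := hd.isUnit_add_right_of_commute h1 (Algebra.commutes _ _).symm
    rwa [map_sub, sub_add_sub_cancel] at h2
  have hstep : f ≫ (y - algebraMap k (End Y) c : End Y) =
      (x - algebraMap k (End X) c : End X) ≫ f := by
    refine (Preadditive.comp_sub _ _ _).trans (Eq.trans ?_ (Preadditive.sub_comp _ _ _).symm)
    refine congrArg₂ _ hxy ?_
    rw [Algebra.algebraMap_eq_smul_one, Algebra.algebraMap_eq_smul_one]
    change f ≫ (c • 𝟙 Y) = (c • 𝟙 X) ≫ f
    simp
  have hpow : ∀ m : ℕ, f ≫ ((y - algebraMap k (End Y) c) ^ m : End Y) =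
      ((x - algebraMap k (End X) c) ^ m : End X) ≫ f := by
    intro m
    induction m with
    | zero => exact (Category.comp_id f).trans (Category.id_comp f).symm
    | succ m ih =>
      rw [pow_succ' (y - _), pow_succ' (x - _), End.mul_def, End.mul_def, ← Category.assoc, ih,
        Category.assoc, hstep, Category.assoc]
  have hzero : f ≫ ((y - algebraMap k (End Y) c) ^ n : End Y) = 0 := by
    rw [hpow, hn]
    exact zero_comp
  obtain ⟨r, hr⟩ := (hunit.pow n).exists_left_inv
  have hr' : ((y - algebraMap k (End Y) c) ^ n : End Y) ≫ r = 𝟙 Y := hr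
  rw [← Category.comp_id f, ← hr', ← Category.assoc, hzero, zero_comp]

/-- A natural endomorphism of the identity functor acts by equal scalars on objects of the same
block. -/
theorem scalar_eq_of_sameBlock [IsAlgClosed k] (hfin : ∀ X : C, FiniteDimensional k (X ⟶ X))
    (g : 𝟭 C ⟶ 𝟭 C) {X Y : {X : C // Indecomposable X}} (h : SameBlock X Y) {c d : k}
    (hc : g.app X.1 = c • 𝟙 X.1) (hd : g.app Y.1 = d • 𝟙 Y.1) : c = d := by
  have hex : ∀ X : {X : C // Indecomposable X},
      ∃ c : k, IsNilpotent ((show End X.1 from g.app X.1) - algebraMap k (End X.1) c) := by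
    intro X
    have : FiniteDimensional k (End X.1) := hfin X.1
    have : Nontrivial (End X.1) :=
      ⟨(1 : End X.1), 0, fun h => X.2.1 ((IsZero.iff_id_eq_zero X.1).2 h)⟩
    exact exists_isNilpotent_sub_algebraMap
      (fun e he => eq_zero_or_eq_id_of_indecomposable X.2 he) _
  -- `a X` is the single eigenvalue of `g` on `X`; it is defined on non-simple objects as well, as
  -- the chain of nonzero morphisms connecting two objects of a block passes through those
  choose a ha using hex
  have hblock : a X = a Y := by
    clear hc hd
    induction h with
    | rel X Y h =>
      exact eigenvalue_eq_of_ne_zero h.choose_spec (g.naturality h.choose) (ha X) (ha Y)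
    | refl => rfl
    | symm _ _ _ ih => exact ih.symm
    | trans _ _ _ _ _ ih₁ ih₂ => exact ih₁.trans ih₂
  have hself : ∀ (X : {X : C // Indecomposable X}) (c : k), g.app X.1 = c • 𝟙 X.1 → c = a X := by
    intro X c hc
    refine eigenvalue_eq_of_ne_zero (f := 𝟙 X.1)
      (fun h => X.2.1 ((IsZero.iff_id_eq_zero X.1).2 h)) (g.naturality (𝟙 X.1)) ?_ (ha X)
    have : (show End X.1 from g.app X.1) = algebraMap k (End X.1) c := by
      rw [Algebra.algebraMap_eq_smul_one]; exact hc
    exact ⟨1, (pow_one _).trans (sub_eq_zero.2 this)⟩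
  rw [hself X c hc, hself Y d hd, hblock]

end Scalars

/-! ### Extending functions from simple to indecomposable objects -/

section Blocks

variable {k : Type w} {C : Type u} [Field k] [Category.{v} C] [Abelian C]

/-- Every indecomposable object of finite length belongs to the block of one of the chosen
representatives of the simple objects. -/
theorem exists_sameBlock_simple {S : SimpleClass C → SimpleObject C}
    (hS : ∀ i, SimpleClass.mk (S i) = i) (Z : {X : C // Indecomposable X})
    (hZ : HasFiniteLength Z.1) : ∃ i, SameBlock (S i).toIndecomposable Z := by
  have := hZ.2
  -- the inclusion of a simple subobject is a nonzero morphism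
  obtain ⟨A, hA⟩ := exists_simple_subobject Z.2.1
  obtain ⟨e⟩ : IsIsomorphic (S (SimpleClass.mk ⟨(A : C), hA⟩)).1 (A : C) :=
    Quotient.exact (hS (SimpleClass.mk ⟨(A : C), hA⟩))
  refine ⟨SimpleClass.mk ⟨(A : C), hA⟩, Relation.EqvGen.rel _ _ ⟨e.hom ≫ A.arrow, fun h => ?_⟩⟩
  have := (S (SimpleClass.mk ⟨(A : C), hA⟩)).2
  have h0 : 𝟙 (S (SimpleClass.mk ⟨(A : C), hA⟩)).1 = 0 := by
    refine (cancel_mono (e.hom ≫ A.arrow)).1 ?_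
    exact (congrArg _ h).trans (comp_zero.trans zero_comp.symm)
  exact id_nonzero _ h0

/-- A function on the simple objects which is constant on blocks extends to a function on the
indecomposable objects which is constant along nonzero morphisms. -/
theorem exists_weight (hlen : ∀ X : C, HasFiniteLength X) {S : SimpleClass C → SimpleObject C}
    (hS : ∀ i, SimpleClass.mk (S i) = i) {l : SimpleClass C → kˣ}
    (hl : ∀ i j, SameBlock (S i).toIndecomposable (S j).toIndecomposable → l i = l j) :
    ∃ b : {X : C // Indecomposable X} → kˣ,
      (∀ (X Y : {X : C // Indecomposable X}) (f : X.1 ⟶ Y.1), f ≠ 0 → b X = b Y) ∧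
      ∀ T : SimpleObject C, b T.toIndecomposable = l (SimpleClass.mk T) := by
  choose i hi using fun Z => exists_sameBlock_simple hS Z (hlen Z.1)
  refine ⟨fun Z => l (i Z), fun X Y f hf => ?_, fun T => ?_⟩
  · exact hl _ _ ((hi X).trans _ _ _ ((Relation.EqvGen.rel _ _ ⟨f, hf⟩).trans _ _ _
      ((hi Y).symm)))
  · obtain ⟨e⟩ : IsIsomorphic (S (SimpleClass.mk T)).1 T.1 :=
      Quotient.exact (hS (SimpleClass.mk T))
    have := T.2
    have he : e.inv ≠ 0 := fun h => id_nonzero T.1 (by rw [← e.inv_hom_id, h, zero_comp])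
    exact hl _ _ ((hi _).trans _ _ _ (Relation.EqvGen.rel _ _ ⟨e.inv, he⟩))

end Blocks

/-! ### Compatibility with the tensor product -/

section Monoidal

variable {k : Type w} {C : Type u} [Field k] [Category.{v} C] [Abelian C] [Linear k C]
  [MonoidalCategory C] [MonoidalPreadditive C] [MonoidalLinear k C]

theorem smul_id_tensorHom (c d : k) (X Y : C) :
    ((c • 𝟙 X) ⊗ₘ (d • 𝟙 Y) : X ⊗ Y ⟶ X ⊗ Y) = (c * d) • 𝟙 (X ⊗ Y) := by
  rw [MonoidalCategory.tensorHom_def]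
  simp [smul_smul, mul_comm]

/-- A natural endomorphism of the identity functor which is compatible with tensor products and a
nonzero scalar on the unit object is monoidal: compatibility with `𝟙 ⊗ 𝟙 ≅ 𝟙` makes the scalar
idempotent, hence equal to `1`. -/
theorem isMonoidal_of_app_tensor
    (hunit : ¬ IsZero (𝟙_ C)) (g : 𝟭 C ⟶ 𝟭 C) {c : k} (hc0 : c ≠ 0)
    (hc : g.app (𝟙_ C) = c • 𝟙 (𝟙_ C))
    (h : ∀ X Y : C, g.app (X ⊗ Y) = (g.app X ⊗ₘ g.app Y : X ⊗ Y ⟶ X ⊗ Y)) :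
    NatTrans.IsMonoidal g := by
  have h1 : g.app (𝟙_ C ⊗ 𝟙_ C) = (c * c) • 𝟙 (𝟙_ C ⊗ 𝟙_ C) := by
    rw [h, hc]
    change ((c • 𝟙 (𝟙_ C)) ⊗ₘ (c • 𝟙 (𝟙_ C)) : 𝟙_ C ⊗ 𝟙_ C ⟶ 𝟙_ C ⊗ 𝟙_ C) = _
    rw [smul_id_tensorHom]
  have h2 : (λ_ (𝟙_ C)).hom ≫ (c • 𝟙 (𝟙_ C)) = (λ_ (𝟙_ C)).hom ≫ ((c * c) • 𝟙 (𝟙_ C)) := by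
    have hnat : (λ_ (𝟙_ C)).hom ≫ g.app (𝟙_ C) = g.app (𝟙_ C ⊗ 𝟙_ C) ≫ (λ_ (𝟙_ C)).hom :=
      g.naturality _
    rw [hc, h1] at hnat
    refine hnat.trans ?_
    change ((c * c) • 𝟙 (𝟙_ C ⊗ 𝟙_ C)) ≫ (λ_ (𝟙_ C)).hom = _
    simp
  have hcc : c = c * c := smul_id_injective hunit ((cancel_epi _).1 h2)
  have hc1 : c = 1 := by
    have : c * 1 = c * c := by rw [mul_one]; exact hcc
    exact (mul_left_cancel₀ hc0 this).symm
  constructor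
  · change 𝟙 _ ≫ g.app (𝟙_ C) = 𝟙 _
    rw [hc, hc1, one_smul]
    exact Category.comp_id _
  · intro X Y
    change 𝟙 _ ≫ g.app (X ⊗ Y) = (g.app X ⊗ₘ g.app Y) ≫ 𝟙 _
    rw [h]
    exact (Category.id_comp _).trans (Category.comp_id _).symm

end Monoidal

section Tensor

variable {k : Type w} {C : Type u} [Field k] [Category.{v} C] [Abelian C] [Linear k C]
  [MonoidalCategory C] [RigidCategory C]

/-- Compatibility of a natural endomorphism of the identity functor with the tensor product may be
checked on indecomposable objects. -/
theorem app_tensor_of_indecomposable (hfin : ∀ X : C, FiniteDimensional k (X ⟶ X))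
    (g : 𝟭 C ⟶ 𝟭 C)
    (h : ∀ X Y : {X : C // Indecomposable X},
      g.app (X.1 ⊗ Y.1) = (g.app X.1 ⊗ₘ g.app Y.1 : X.1 ⊗ Y.1 ⟶ X.1 ⊗ Y.1))
    (X Y : C) : g.app (X ⊗ Y) = (g.app X ⊗ₘ g.app Y : X ⊗ Y ⟶ X ⊗ Y) := by
  have hnat : ∀ {A B : C} (f : A ⟶ B), f ≫ g.app B = g.app A ≫ f := fun f => g.naturality f
  have h' : ∀ (X : C) (Y : {X : C // Indecomposable X}),
      g.app (X ⊗ Y.1) = (g.app X ⊗ₘ g.app Y.1 : X ⊗ Y.1 ⟶ X ⊗ Y.1) := by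
    intro X Y
    refine hom_ext_of_adjunction hfin (F := tensorRight Y.1)
      (tensorRightAdjunction Y.1 (Y.1ᘁ)) fun Z i => ?_
    change i ▷ Y.1 ≫ g.app (X ⊗ Y.1) = i ▷ Y.1 ≫ (g.app X ⊗ₘ g.app Y.1)
    rw [hnat, h]
    change (g.app Z.1 ⊗ₘ g.app Y.1 : Z.1 ⊗ Y.1 ⟶ Z.1 ⊗ Y.1) ≫ i ▷ Y.1 = _
    rw [← tensorHom_id, tensorHom_comp_tensorHom, tensorHom_comp_tensorHom, hnat i]
    simp
  refine hom_ext_of_adjunction hfin (F := tensorLeft X)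
    (tensorLeftAdjunction (ᘁX) X) fun Z i => ?_
  change X ◁ i ≫ g.app (X ⊗ Y) = X ◁ i ≫ (g.app X ⊗ₘ g.app Y)
  rw [hnat, h']
  change (g.app X ⊗ₘ g.app Z.1 : X ⊗ Z.1 ⟶ X ⊗ Z.1) ≫ X ◁ i = _
  rw [← id_tensorHom, tensorHom_comp_tensorHom, tensorHom_comp_tensorHom, hnat i]
  simp

/-- By exactness of the tensor product, a property closed under extensions holds for `X ⊗ Y` if it
holds for the tensor products of the composition factors of `X` and `Y`. -/
theorem prop_tensor_of_compositionFactors [MonoidalPreadditive C]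
    (P : ObjectProperty C) [P.IsClosedUnderExtensions] (hP : ∀ Z : C, IsZero Z → P Z)
    {X Y : C} (hX : HasFiniteLength X) (hY : HasFiniteLength Y)
    (h : ∀ T U : C, Simple T → Simple U → IsCompositionFactor T X → IsCompositionFactor U Y →
      P (T ⊗ U)) : P (X ⊗ Y) := by
  have hl : ∀ A : C, (P.inverseImage (tensorLeft A)).IsClosedUnderExtensions := fun A => by
    have := (tensorLeftAdjunction (ᘁA) A).leftAdjoint_preservesColimits
    have := (tensorLeftAdjunction A (Aᘁ)).rightAdjoint_preservesLimits
    infer_instance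
  have hr : ∀ A : C, (P.inverseImage (tensorRight A)).IsClosedUnderExtensions := fun A => by
    have := (tensorRightAdjunction A (Aᘁ)).leftAdjoint_preservesColimits
    have := (tensorRightAdjunction (ᘁA) A).rightAdjoint_preservesLimits
    infer_instance
  refine prop_of_compositionFactors (P.inverseImage (tensorRight Y))
    (fun Z hZ => hP _ ((tensorRight Y).map_isZero hZ)) hX fun T hT hTX => ?_
  exact prop_of_compositionFactors (P.inverseImage (tensorLeft T))
    (fun Z hZ => hP _ ((tensorLeft T).map_isZero hZ)) hY fun U hU hUY => h T U hT hU hTX hUY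

/-- If a weight function is multiplicative on composition factors of tensor products of simple
objects, then the tensor product of two indecomposable objects is homogeneous, of weight the
product of the two weights. -/
theorem isHomogeneous_tensor [MonoidalPreadditive C] (hlen : ∀ X : C, HasFiniteLength X)
    (hfin : ∀ X : C, FiniteDimensional k (X ⟶ X)) {S : SimpleClass C → SimpleObject C}
    (hS : ∀ i, SimpleClass.mk (S i) = i) {l : SimpleClass C → kˣ}
    (hl : ∀ i j m, IsCompositionFactor (S m).1 ((S i).1 ⊗ (S j).1) → l i * l j = l m)
    {a : {X : C // Indecomposable X} → k}
    (ha : ∀ (X Y : {X : C // Indecomposable X}) (f : X.1 ⟶ Y.1), f ≠ 0 → a X = a Y)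
    (hal : ∀ T : SimpleObject C, a T.toIndecomposable = l (SimpleClass.mk T))
    (X Y : {X : C // Indecomposable X}) : IsHomogeneous a (a X * a Y) (X.1 ⊗ Y.1) := by
  have hrep : ∀ T : SimpleObject C, Nonempty ((S (SimpleClass.mk T)).1 ≅ T.1) := fun T =>
    Quotient.exact (hS (SimpleClass.mk T))
  -- composition factors of an indecomposable object have the same weight as the object
  have hfac : ∀ (X : {X : C // Indecomposable X}) (T : SimpleObject C),
      IsCompositionFactor T.1 X.1 → a X = l (SimpleClass.mk T) := by
    intro X T hT
    have h1 := app_eq_smul_of_isCompositionFactor (weightNatTrans hfin ha)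
      (weightNatTrans_app_of_indecomposable hfin ha X) hT
    have h2 := weightNatTrans_app_of_indecomposable hfin ha T.toIndecomposable
    rw [← hal]
    exact smul_id_injective T.toIndecomposable.2.1 (h1.symm.trans h2)
  refine prop_tensor_of_compositionFactors (IsHomogeneous a (a X * a Y))
    (fun Z hZ => isHomogeneous_of_isZero a _ hZ) (hlen _) (hlen _) fun T U hT hU hTX hUY => ?_
  rw [hfac X ⟨T, hT⟩ hTX, hfac Y ⟨U, hU⟩ hUY]
  obtain ⟨eT⟩ := hrep ⟨T, hT⟩
  obtain ⟨eU⟩ := hrep ⟨U, hU⟩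
  -- the conditions on `l` concern the chosen representatives, so pass to these
  suffices h : IsHomogeneous a ((l (SimpleClass.mk ⟨T, hT⟩) : k) * l (SimpleClass.mk ⟨U, hU⟩))
      ((S (SimpleClass.mk ⟨T, hT⟩)).1 ⊗ (S (SimpleClass.mk ⟨U, hU⟩)).1) from fun Z i hi =>
    h Z (i ≫ (eT.inv ⊗ₘ eU.inv)) fun h0 => hi (by
      rw [← cancel_mono (eT.inv ⊗ₘ eU.inv), h0, zero_comp])
  refine prop_of_compositionFactors (IsHomogeneous a _)
    (fun Z hZ => isHomogeneous_of_isZero a _ hZ) (hlen _) fun V hV hVf Z i hi => ?_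
  obtain ⟨eV⟩ := hrep ⟨V, hV⟩
  have h := hl _ _ (SimpleClass.mk ⟨V, hV⟩) (hVf.of_iso_left eV)
  rw [ha Z (SimpleObject.toIndecomposable ⟨V, hV⟩) i hi, hal, ← h, Units.val_mul]

end Tensor

end FinTens

theorem mainTheorem6 {k : Type w} {C : Type u} [Field k] [IsAlgClosed k] [Category.{v} C]
    [Abelian C] [Linear k C] [MonoidalCategory C] [RigidCategory C]
    [FinTens.FiniteTensorCategory k C]
    (S : FinTens.SimpleClass C → FinTens.SimpleObject C)
    (hS : ∀ i, FinTens.SimpleClass.mk (S i) = i) :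
    Set.range (FinTens.phi k S) =
      {l : FinTens.SimpleClass C → kˣ |
        (∀ i j m : FinTens.SimpleClass C,
          FinTens.IsCompositionFactor (S m).1 ((S i).1 ⊗ (S j).1) → l i * l j = l m) ∧
        (∀ i j : FinTens.SimpleClass C,
          FinTens.SameBlock (S i).toIndecomposable (S j).toIndecomposable → l i = l j)} := by
  have : MonoidalPreadditive C := FinTens.TensorCategory.monoidalPreadditive k
  have : MonoidalLinear k C := FinTens.TensorCategory.monoidalLinear
  have hunit : Simple (𝟙_ C) := FinTens.TensorCategory.simple_unit k
  have hlen : ∀ X : C, FinTens.HasFiniteLength X := FinTens.TensorCategory.finiteLength k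
  have hfin : ∀ X : C, FiniteDimensional k (X ⟶ X) :=
    fun X => FinTens.TensorCategory.finite_hom X X
  have hnz : ∀ i, ¬ IsZero (S i).1 := fun i => (S i).toIndecomposable.2.1
  apply Set.Subset.antisymm
  · rintro _ ⟨g, rfl⟩
    refine ⟨fun i j m h => ?_, fun i j h => ?_⟩
    · have hg : NatTrans.IsMonoidal g.1.hom := g.2
      -- monoidality makes `g` the scalar `φ(g)(i) φ(g)(j)` on the whole of `S i ⊗ S j`
      have ht : g.1.hom.app ((S i).1 ⊗ (S j).1) =
          (((FinTens.phi k S g i : kˣ) : k) * ((FinTens.phi k S g j : kˣ) : k)) •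
            𝟙 ((S i).1 ⊗ (S j).1) := by
        have h0 : 𝟙 _ ≫ g.1.hom.app ((S i).1 ⊗ (S j).1) =
          (g.1.hom.app (S i).1 ⊗ₘ g.1.hom.app (S j).1) ≫ 𝟙 _ := hg.tensor (S i).1 (S j).1
        rw [Category.id_comp, FinTens.phi_spec k S, FinTens.phi_spec k S] at h0
        refine h0.trans ((Category.comp_id _).trans ?_)
        change ((((FinTens.phi k S g i : kˣ) : k) • 𝟙 (S i).1) ⊗ₘ
          (((FinTens.phi k S g j : kˣ) : k) • 𝟙 (S j).1) : (S i).1 ⊗ (S j).1 ⟶ _) = _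
        rw [FinTens.smul_id_tensorHom]
      have hm := FinTens.app_eq_smul_of_isCompositionFactor g.1.hom ht h
      rw [FinTens.phi_spec k S] at hm
      exact Units.ext (FinTens.smul_id_injective (hnz m) hm).symm
    · exact Units.ext (FinTens.scalar_eq_of_sameBlock hfin g.1.hom h
        (FinTens.phi_spec k S g i) (FinTens.phi_spec k S g j))
  · rintro l ⟨hl₁, hl₂⟩
    -- `b` extends `l` to indecomposable objects, and `g` is multiplication by `b`
    obtain ⟨b, hb, hbl⟩ := FinTens.exists_weight hlen hS hl₂
    have ha : ∀ (X Y : {X : C // Indecomposable X}) (f : X.1 ⟶ Y.1), f ≠ 0 →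
        (b X : k) = b Y := fun X Y f hf => by rw [hb X Y f hf]
    let g := FinTens.weightNatTrans hfin ha
    have hg : ∀ X : {X : C // Indecomposable X}, g.app X.1 = (b X : k) • 𝟙 X.1 :=
      FinTens.weightNatTrans_app_of_indecomposable hfin ha
    have ht : ∀ X Y : C, g.app (X ⊗ Y) = (g.app X ⊗ₘ g.app Y : X ⊗ Y ⟶ X ⊗ Y) := by
      refine FinTens.app_tensor_of_indecomposable hfin g fun X Y => ?_
      refine (FinTens.weightNatTrans_app_of_isHomogeneous hfin ha
        (FinTens.isHomogeneous_tensor hlen hfin hS hl₁ ha (fun T => by rw [hbl]) X Y)).trans ?_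
      rw [hg, hg]
      change _ = (((b X : k) • 𝟙 X.1) ⊗ₘ ((b Y : k) • 𝟙 Y.1) : X.1 ⊗ Y.1 ⟶ X.1 ⊗ Y.1)
      rw [FinTens.smul_id_tensorHom]
    have hmon : NatTrans.IsMonoidal g :=
      FinTens.isMonoidal_of_app_tensor (Simple.not_isZero _) g (Units.ne_zero _)
        (hg (FinTens.SimpleObject.toIndecomposable ⟨𝟙_ C, hunit⟩)) ht
    refine ⟨⟨FinTens.weightAut hfin hb, hmon⟩, ?_⟩
    funext i
    have h1 := FinTens.phi_spec k S ⟨FinTens.weightAut hfin hb, hmon⟩ i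
    have h2 := hg (S i).toIndecomposable
    rw [hbl, hS] at h2
    exact Units.ext (FinTens.smul_id_injective (hnz i) (h1.symm.trans h2))
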